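/- Let $D(p,y)$ be an optimal conditional decompressor, i.e. a partial computable function of two binary strings such that for every partial computable $D'(p,y)$ there is a constant $c'$ such that whenever $D'(p,y)=x$ there is a $q$ with $D(q,y)=x$ and $|q|\le |p|+c'$. Let $K(x|y)=\min\{|p| : D(p,y)=x\}$ be the corresponding plain conditional Kolmogorov complexity, and let $K(x)=K(x|\Lambda)$, where $\Lambda$ is the empty string. Theorem. Let $P$ be a polynomial with real coefficients. There is a constant $c>0$ (depending only on $D$ and $P$) such that for every binary string $x$ and all integers $n,m$ with $n\ge 1$ and $$n+c\log_2 n\le K(x)\le P(n),\qquad c\log_2 n\le m\le P(n),$$ there is a binary string $y$ with $|K(x|y)-n|\le c$ and $|K(y|x)-m|\le c$. -/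

import Mathlib

/-- A binary string. -/
abbrev BinStr : Type := List Bool

/-- A conditional decompressor: a partial computable function of two binary strings, the
description `p` and the condition `y`. No prefix-freeness is imposed (plain complexity). -/
def IsDecompressor (D : BinStr → BinStr →. BinStr) : Prop :=
  Partrec₂ D

/-- `D` is an optimal conditional decompressor: for every conditional decompressor `D'`, each
`D'`-description can be replaced by a `D`-description of the same string under the same condition
that is longer by at most a constant depending only on `D'`. -/
def IsOptimalDecompressor (D : BinStr → BinStr →. BinStr) : Prop :=
  IsDecompressor D ∧
    ∀ D' : BinStr → BinStr →. BinStr, IsDecompressor D' →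
      ∃ c : ℕ, ∀ p y x : BinStr, x ∈ D' p y →
        ∃ q : BinStr, x ∈ D q y ∧ q.length ≤ p.length + c

/-- The plain conditional complexity `K(x | y)` with respect to `D`: the least length of a
description of `x` under the condition `y`. -/
noncomputable def condComplexity (D : BinStr → BinStr →. BinStr) (x y : BinStr) : ℕ :=
  sInf {k : ℕ | ∃ p : BinStr, x ∈ D p y ∧ p.length = k}

/-- The plain complexity `K(x)`: the condition is the empty string. -/
noncomputable def plainComplexity (D : BinStr → BinStr →. BinStr) (x : BinStr) : ℕ :=
  condComplexity D x []

/-- With respect to an optimal decompressor every string has a description under every condition,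
and a shortest one realizes the complexity (so `sInf` never takes its value at the empty set). -/
theorem IsOptimalDecompressor.exists_shortest {D : BinStr → BinStr →. BinStr}
    (hD : IsOptimalDecompressor D) (x y : BinStr) :
    ∃ p : BinStr, x ∈ D p y ∧ p.length = condComplexity D x y := by
  have hid : IsDecompressor (fun p _ => Part.some p) :=
    (Computable.fst (α := BinStr) (β := BinStr)).partrec
  obtain ⟨c, hc⟩ := hD.2 _ hid
  obtain ⟨q, hq, -⟩ := hc x y x (Part.mem_some x)
  exact Nat.sInf_mem (s := {k : ℕ | ∃ p : BinStr, x ∈ D p y ∧ p.length = k}) ⟨q.length, q, hq, rfl⟩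

/-- The standard universal decompressor: on `1ᵉ 0 p` and `y` it runs program number `e` on the
pair `(p, y)`. -/
def universalDecompressor (q y : BinStr) : Part BinStr :=
  (Nat.Partrec.Code.eval (Denumerable.ofNat Nat.Partrec.Code (q.findIdx (fun b => !b)))
    (Encodable.encode (q.drop (q.findIdx (fun b => !b) + 1), y))).bind
      fun k => (Encodable.decode (α := BinStr) k : Part BinStr)

/-- Optimal decompressors exist. -/
theorem universalDecompressor_optimal : IsOptimalDecompressor universalDecompressor := by
  refine ⟨?_, ?_⟩
  · have hidx : Computable (fun a : BinStr × BinStr => a.1.findIdx (fun b => !b)) :=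
      (Primrec.list_findIdx Primrec.fst (Primrec.not.comp Primrec.snd).to₂).to_comp
    have hit : Computable (fun a : BinStr × BinStr =>
        a.1.drop (a.1.findIdx (fun b => !b) + 1)) :=
      (Primrec.list_drop.comp
        (Primrec.succ.comp
          (Primrec.list_findIdx Primrec.fst (Primrec.not.comp Primrec.snd).to₂))
        Primrec.fst).to_comp
    have h1 : Partrec (fun a : BinStr × BinStr => Nat.Partrec.Code.eval
        (Denumerable.ofNat Nat.Partrec.Code (a.1.findIdx (fun b => !b)))
        (Encodable.encode
          (a.1.drop (a.1.findIdx (fun b => !b) + 1), a.2))) :=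
      Nat.Partrec.Code.eval_part.comp ((Computable.ofNat Nat.Partrec.Code).comp hidx)
        (Computable.encode.comp (hit.pair Computable.snd))
    exact h1.bind (Computable.ofOption (Computable.decode.comp Computable.snd)).to₂
  · intro D' hD'
    obtain ⟨code, hcode⟩ := Nat.Partrec.Code.exists_code.1 hD'
    refine ⟨Encodable.encode code + 1, fun p y x hx => ?_⟩
    have hidx : ∀ e : ℕ, (List.replicate e true ++ false :: p).findIdx (fun b => !b) = e := by
      intro e
      induction e with
      | zero => simp [List.findIdx_cons]
      | succ e ih => simp [List.replicate_succ, List.findIdx_cons, ih]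
    have hdrop : ∀ e : ℕ, (List.replicate e true ++ false :: p).drop (e + 1) = p := by
      intro e
      induction e with
      | zero => simp
      | succ e ih => simpa [List.replicate_succ] using ih
    refine ⟨List.replicate (Encodable.encode code) true ++ false :: p, ?_, by simp; omega⟩
    unfold universalDecompressor
    rw [hidx, hdrop, Denumerable.ofNat_encode, hcode]
    simp only [Encodable.encodek, Part.coe_some, Part.bind_some]
    simpa using hx

/-!
The proof is topological. Let `p` be a shortest description of `x` and let `z` be a string that is
random given `x` and useless for describing `x`. Consider the conditions
`y i j = codePair (p.drop i, z.drop j)`. The more of `p` is kept, the smaller is `K(x | y)`, and the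
more of `z` is kept, the larger is `K(y | x)`, but only up to logarithmic terms, so choosing `i` and
`j` one after the other gives `(n, m)` with logarithmic precision only. However, a unit step in `i`
or `j` changes both complexities by `O(1)` (`IsOptimalDecompressor.exists_abs_sub_drop_le`), while
on the boundary of the grid the logarithmic estimates suffice to see on which side of `n` and of `m`
the complexities lie:

* for `i = 0` the condition contains `p`, so `K(x | y) = O(1)`;
* for `i = |p|` only a part of `z` is left, so `K(x | y)` is about `K(x)`;
* for `j = 0` the whole of `z` is present, so `K(y | x)` exceeds `m`;
* for `j = |z|` only a part of `p` is left, so `K(y | x)` is logarithmic.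

The discrete Poincaré–Miranda theorem `exists_near_levels`, a consequence of Sperner's parity
argument on a grid, then gives a grid point where both complexities are within `O(1)` of their
targets.

The string `p` has to be the shortest description that is found first, so that it is simple given
`x` (`IsOptimalDecompressor.exists_simple_shortest`). The string `z` is found by counting
(`IsOptimalDecompressor.exists_independent`): more than half of the strings of a given length are
random given `x`. If all of them helped to describe `x`, then `x` would belong to a small enumerable
set, the strings that are simple under at least half of the conditions of that length, and its rank
in the enumeration would be too short a description
(`IsOptimalDecompressor.exists_plainComplexity_le_of_half`).
-/

/-! ### A discrete intermediate value theorem in the plane -/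

/-- The parity of an edge: `1` if its endpoints carry the colours `1` and `2`, else `0`. -/
def edgeParity (u v : Fin 3) : ZMod 2 :=
  if (u = 1 ∧ v = 2) ∨ (u = 2 ∧ v = 1) then 1 else 0

/-- Sperner's lemma for one square: unless its vertices carry all three colours, an even number of
its sides join the colours `1` and `2`. -/
theorem edgeParity_square (p q r s : Fin 3)
    (h : ∃ a : Fin 3, p ≠ a ∧ q ≠ a ∧ r ≠ a ∧ s ≠ a) :
    edgeParity p q + edgeParity r s = edgeParity p r + edgeParity q s := by
  revert p q r s
  decide

/-- Sperner's lemma on a rectangular grid: a colouring of `[0, L] × [0, T]` by three colours in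
which the left side has colour `0`, the right side avoids `0`, the bottom side avoids `1` and the
top side avoids `2`, has a unit square with vertices of all three colours. -/
theorem exists_square_all_colours (col : ℕ → ℕ → Fin 3) (L T : ℕ)
    (hleft : ∀ j ≤ T, col 0 j = 0) (hright : ∀ j ≤ T, col L j ≠ 0)
    (hbot : ∀ i ≤ L, col i 0 ≠ 1) (htop : ∀ i ≤ L, col i T ≠ 2) :
    ∃ i j : ℕ, ∀ a : Fin 3,
      col i j = a ∨ col i (j + 1) = a ∨ col (i + 1) j = a ∨ col (i + 1) (j + 1) = a := by
  by_contra hcon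
  push Not at hcon
  have hbot' : ∀ u v : Fin 3, u ≠ 1 → v ≠ 1 → edgeParity u v = 0 := by decide
  have htop' : ∀ u v : Fin 3, u ≠ 2 → v ≠ 2 → edgeParity u v = 0 := by decide
  -- The number of `1`-`2` edges in the column `i`, modulo two, does not depend on `i`.
  have hstrip : ∀ i T', ∑ j ∈ Finset.range T', edgeParity (col i j) (col i (j + 1)) +
      ∑ j ∈ Finset.range T', edgeParity (col (i + 1) j) (col (i + 1) (j + 1)) =
      edgeParity (col i 0) (col (i + 1) 0) + edgeParity (col i T') (col (i + 1) T') := by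
    intro i T'
    induction T' with
    | zero => simp [CharTwo.add_self_eq_zero]
    | succ T' ih =>
      rw [Finset.sum_range_succ, Finset.sum_range_succ]
      have hsq := edgeParity_square _ _ _ _ (hcon i T')
      have h2 := CharTwo.add_self_eq_zero (edgeParity (col i T') (col (i + 1) T'))
      linear_combination ih + hsq + h2
  have hcolumn : ∀ i ≤ L, ∑ j ∈ Finset.range T, edgeParity (col i j) (col i (j + 1)) = 0 := by
    intro i
    induction i with
    | zero =>
      refine fun _ => Finset.sum_eq_zero fun j hj => ?_
      have hj' := Finset.mem_range.1 hj
      rw [hleft j hj'.le, hleft (j + 1) hj']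
      decide
    | succ i ih =>
      intro hi
      have h := hstrip i T
      rw [ih (by omega), hbot' _ _ (hbot i (by omega)) (hbot (i + 1) hi),
        htop' _ _ (htop i (by omega)) (htop (i + 1) hi)] at h
      simpa using h
  -- The last column starts with colour `2` and ends with colour `1`, avoiding `0`.
  have hlast : ∀ T' ≤ T, ∑ j ∈ Finset.range T', edgeParity (col L j) (col L (j + 1)) =
      if col L T' = 1 then 1 else 0 := by
    intro T'
    induction T' with
    | zero => simp [hbot L le_rfl]
    | succ T' ih =>
      intro hT
      rw [Finset.sum_range_succ, ih (by omega)]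
      have key : ∀ u v : Fin 3, u ≠ 0 → v ≠ 0 →
          (if u = 1 then 1 else 0) + edgeParity u v = if v = 1 then 1 else 0 := by decide
      exact key _ _ (hright _ (by omega)) (hright _ hT)
  have h1 : col L T = 1 := by
    have key : ∀ u : Fin 3, u ≠ 0 → u ≠ 2 → u = 1 := by decide
    exact key _ (hright T le_rfl) (htop L le_rfl)
  have h := hlast T le_rfl
  rw [hcolumn L le_rfl, if_pos h1] at h
  exact absurd h (by decide)

/-- A discrete form of the Poincaré–Miranda theorem: a pair `(f, g)` of functions on a grid that
change by at most `c` at each step, such that `f` crosses the level `a` from left to right and `g`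
crosses the level `b` from bottom to top, is close to `(a, b)` somewhere. -/
theorem exists_near_levels (f g : ℕ → ℕ → ℤ) (L T : ℕ) (a b c : ℤ)
    (hf₁ : ∀ i j, |f (i + 1) j - f i j| ≤ c) (hf₂ : ∀ i j, |f i (j + 1) - f i j| ≤ c)
    (hg₁ : ∀ i j, |g (i + 1) j - g i j| ≤ c) (hg₂ : ∀ i j, |g i (j + 1) - g i j| ≤ c)
    (hleft : ∀ j, f 0 j < a) (hright : ∀ j, j ≤ T → a ≤ f L j)
    (hbot : ∀ i, b ≤ g i 0) (htop : ∀ i, i ≤ L → g i T < b) :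
    ∃ i j, |f i j - a| ≤ 2 * c ∧ |g i j - b| ≤ 2 * c := by
  obtain ⟨i, j, h⟩ := exists_square_all_colours
    (fun i j => if f i j < a then 0 else if g i j < b then 1 else 2) L T
    (fun j _ => if_pos (hleft j))
    (fun j hj => by simp only [not_lt.2 (hright j hj), if_false]; split_ifs <;> decide)
    (fun i _ => by simp only [not_lt.2 (hbot i), if_false]; split_ifs <;> decide)
    (fun i hi => by simp only [htop i hi, if_true]; split_ifs <;> decide)
  refine ⟨i, j, ?_⟩
  have e₁ := abs_le.1 (hf₁ i j)
  have e₂ := abs_le.1 (hf₂ i j)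
  have e₃ := abs_le.1 (hf₂ (i + 1) j)
  have e₄ := abs_le.1 (hg₁ i j)
  have e₅ := abs_le.1 (hg₂ i j)
  have e₆ := abs_le.1 (hg₂ (i + 1) j)
  have hc0 : ∀ x y : ℤ, (if x < a then (0 : Fin 3) else if y < b then 1 else 2) = 0 → x < a := by
    intro x y; split_ifs <;> simp [*]
  have hc1 : ∀ x y : ℤ, (if x < a then (0 : Fin 3) else if y < b then 1 else 2) = 1 →
      a ≤ x ∧ y < b := by
    intro x y; split_ifs with h₁ h₂ <;> first | (simp; omega) | simp
  have hc2 : ∀ x y : ℤ, (if x < a then (0 : Fin 3) else if y < b then 1 else 2) = 2 →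
      a ≤ x ∧ b ≤ y := by
    intro x y; split_ifs with h₁ h₂ <;> first | (simp; omega) | simp
  have h0 := (h 0).imp (hc0 _ _) (Or.imp (hc0 _ _) (Or.imp (hc0 _ _) (hc0 _ _)))
  have h1 := (h 1).imp (hc1 _ _) (Or.imp (hc1 _ _) (Or.imp (hc1 _ _) (hc1 _ _)))
  have h2 := (h 2).imp (hc2 _ _) (Or.imp (hc2 _ _) (Or.imp (hc2 _ _) (hc2 _ _)))
  clear h hc0 hc1 hc2
  have hlow : f i j < a + 2 * c := by
    rcases h0 with h0 | h0 | h0 | h0 <;> linarith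
  have hhigh : a ≤ f i j + 2 * c := by
    rcases h1 with h1 | h1 | h1 | h1 <;> linarith
  have glow : g i j < b + 2 * c := by
    rcases h1 with h1 | h1 | h1 | h1 <;> linarith
  have ghigh : b ≤ g i j + 2 * c := by
    rcases h2 with h2 | h2 | h2 | h2 <;> linarith
  exact ⟨abs_le.2 ⟨by linarith, by linarith⟩, abs_le.2 ⟨by linarith, by linarith⟩⟩

/-! ### Computability tools -/

/-- A partial computable function is the limit of an increasing sequence of primitive recursive
partial functions, its values after `t` steps of computation. -/
theorem Partrec.exists_primrec_approx {α β : Type*} [Primcodable α] [Primcodable β] {f : α →. β}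
    (hf : Partrec f) :
    ∃ F : ℕ → α → Option β, Primrec₂ F ∧
      (∀ s t a b, s ≤ t → F s a = some b → F t a = some b) ∧
      ∀ a b, b ∈ f a ↔ ∃ t, F t a = some b := by
  obtain ⟨code, hcode⟩ := Nat.Partrec.Code.exists_code.1 hf
  refine ⟨fun t a => (Nat.Partrec.Code.evaln t code (Encodable.encode a)).bind
    (Encodable.decode (α := β)), ?_, ?_, ?_⟩
  · refine Primrec.option_bind ?_ (Primrec.decode.comp Primrec.snd).to₂
    exact Nat.Partrec.Code.primrec_evaln.comp
      ((Primrec.fst.pair (Primrec.const code)).pair (Primrec.encode.comp Primrec.snd))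
  · intro s t a b hst h
    obtain ⟨n, hn, hb⟩ := Option.bind_eq_some_iff.1 h
    exact Option.bind_eq_some_iff.2 ⟨n, Nat.Partrec.Code.evaln_mono hst hn, hb⟩
  · intro a b
    have heval : Nat.Partrec.Code.eval code (Encodable.encode a) =
        (f a).map Encodable.encode := by
      rw [hcode]; simp
    constructor
    · intro h
      have h' : Encodable.encode b ∈ Nat.Partrec.Code.eval code (Encodable.encode a) := by
        rw [heval]; exact Part.mem_map _ h
      obtain ⟨t, ht⟩ := Nat.Partrec.Code.evaln_complete.1 h'
      exact ⟨t, Option.bind_eq_some_iff.2 ⟨_, ht, Encodable.encodek b⟩⟩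
    · rintro ⟨t, h⟩
      obtain ⟨n, hn, hb⟩ := Option.bind_eq_some_iff.1 h
      have h' := Nat.Partrec.Code.evaln_sound (Option.mem_def.2 hn)
      rw [heval] at h'
      obtain ⟨b', hb', rfl⟩ := (Part.mem_map_iff _).1 h'
      rw [Encodable.encodek] at hb
      exact Option.some.inj hb ▸ hb'

/-- The values of `E a 0, …, E a (N - 1)`, without repetitions and in the order of their first
appearance. -/
def firstAppearances {α β : Type*} [DecidableEq β] (E : α → ℕ → Option β) (a : α) : ℕ → List β
  | 0 => []
  | N + 1 => (E a N).elim (firstAppearances E a N) fun b =>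
      if b ∈ firstAppearances E a N then firstAppearances E a N
      else firstAppearances E a N ++ [b]

section firstAppearances

variable {α β : Type*} [DecidableEq β] (E : α → ℕ → Option β) (a : α)

theorem firstAppearances_nodup (N : ℕ) : (firstAppearances E a N).Nodup := by
  induction N with
  | zero => simp [firstAppearances]
  | succ N ih =>
    rw [firstAppearances]
    cases E a N with
    | none => exact ih
    | some b =>
      simp only [Option.elim]
      split_ifs with h
      · exact ih
      · exact List.nodup_append.2 ⟨ih, by simp, by
          intro x hx y hy hxy
          rw [List.mem_singleton] at hy
          exact h (hy ▸ hxy ▸ hx)⟩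

theorem firstAppearances_prefix {M N : ℕ} (h : M ≤ N) :
    firstAppearances E a M <+: firstAppearances E a N := by
  induction h with
  | refl => exact List.prefix_rfl
  | @step N _ ih =>
    refine ih.trans ?_
    rw [firstAppearances]
    cases E a N with
    | none => exact List.prefix_rfl
    | some b =>
      simp only [Option.elim]
      split_ifs
      · exact List.prefix_rfl
      · exact List.prefix_append _ _

theorem mem_firstAppearances {N : ℕ} {b : β} :
    b ∈ firstAppearances E a N ↔ ∃ M < N, E a M = some b := by
  induction N with
  | zero => simp [firstAppearances]
  | succ N ih =>
    simp only [Nat.lt_succ_iff_lt_or_eq, or_and_right, exists_or, exists_eq_left, ← ih]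
    rw [firstAppearances]
    cases E a N with
    | none => simp
    | some b' =>
      simp only [Option.elim]
      split_ifs with h
      · constructor
        · exact Or.inl
        · rintro (h' | h')
          · exact h'
          · exact Option.some.inj h' ▸ h
      · simp [eq_comm]

end firstAppearances

/-- From a primitive recursive enumeration of sets one can compute the members of each set from
their rank in the order of appearance. -/
theorem exists_partrec_rank {α β : Type*} [Primcodable α] [Primcodable β] [DecidableEq β]
    {E : α → ℕ → Option β} (hE : Primrec₂ E) :
    ∃ f : α × ℕ →. β, Partrec f ∧ ∀ a b M,
      (∀ l : List β, l.Nodup → (∀ b' ∈ l, ∃ N, E a N = some b') → l.length ≤ M) →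
      (∃ N, E a N = some b) → ∃ r < M, b ∈ f (a, r) := by
  have hmem : PrimrecRel fun (l : List β) (b : β) => b ∈ l :=
    (PrimrecRel.exists_mem_list (Primrec.eq (α := β))).of_eq fun l b => by simp
  have hL : Primrec₂ (firstAppearances E) := by
    refine (Primrec.nat_rec (f := fun _ : α => ([] : List β))
      (g := fun a q => (E a q.1).elim q.2 fun b => if b ∈ q.2 then q.2 else q.2 ++ [b])
      (Primrec.const []) ?_).of_eq ?_
    · have h1 : Primrec₂ fun (a : α × ℕ × List β) (b : β) =>
          if b ∈ a.2.2 then a.2.2 else a.2.2 ++ [b] := by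
        refine Primrec.ite (hmem.comp
          (Primrec.snd.comp (Primrec.snd.comp Primrec.fst)) Primrec.snd)
          (Primrec.snd.comp (Primrec.snd.comp Primrec.fst)) ?_
        exact Primrec.list_concat.comp (Primrec.snd.comp (Primrec.snd.comp Primrec.fst))
          Primrec.snd
      refine (Primrec.option_casesOn (hE.comp Primrec.fst (Primrec.fst.comp Primrec.snd))
        (Primrec.snd.comp Primrec.snd) h1).of_eq ?_
      rintro ⟨a, N, l⟩
      dsimp only
      cases E a N <;> rfl
    · intro a N
      induction N with
      | zero => rfl
      | succ N ih => rw [firstAppearances, ← ih]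
  refine ⟨fun q => Nat.rfindOpt fun N => (firstAppearances E q.1 N)[q.2]?, ?_, ?_⟩
  · refine Partrec.rfindOpt (Primrec.to_comp ?_)
    exact Primrec.list_getElem?.comp
      (hL.comp (Primrec.fst.comp Primrec.fst) Primrec.snd) (Primrec.snd.comp Primrec.fst)
  · rintro a b M hM ⟨N, hN⟩
    have hb : b ∈ firstAppearances E a (N + 1) :=
      (mem_firstAppearances E a).2 ⟨N, Nat.lt_succ_self N, hN⟩
    obtain ⟨r, hr, hrb⟩ := List.getElem_of_mem hb
    refine ⟨r, hr.trans_le (hM _ (firstAppearances_nodup E a _) fun b' hb' => ?_), ?_⟩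
    · obtain ⟨N', -, h'⟩ := (mem_firstAppearances E a).1 hb'
      exact ⟨N', h'⟩
    · refine (Nat.rfindOpt_mono ?_).2 ⟨N + 1, ?_⟩
      · intro b' m n hmn hb'
        obtain ⟨hr', -⟩ := List.getElem?_eq_some_iff.1 hb'
        obtain ⟨l, hl⟩ := firstAppearances_prefix E a hmn
        rw [← hl, List.getElem?_append_left hr']
        exact hb'
      · exact List.getElem?_eq_some_iff.2 ⟨hr, hrb⟩

/-- The binary strings of length `n`. -/
def stringsOfLength : ℕ → List BinStr
  | 0 => [[]]
  | n + 1 => (stringsOfLength n).map (List.cons false) ++ (stringsOfLength n).map (List.cons true)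

theorem mem_stringsOfLength {n : ℕ} {w : BinStr} : w ∈ stringsOfLength n ↔ w.length = n := by
  induction n generalizing w with
  | zero => simp [stringsOfLength]
  | succ n ih =>
    rcases w with _ | ⟨b, w⟩
    · simp [stringsOfLength]
    · cases b <;> simp [stringsOfLength, ih]

theorem stringsOfLength_nodup (n : ℕ) : (stringsOfLength n).Nodup := by
  induction n with
  | zero => simp [stringsOfLength]
  | succ n ih =>
    rw [stringsOfLength, List.nodup_append]
    refine ⟨ih.map List.cons_injective, ih.map List.cons_injective, ?_⟩
    simp

theorem length_stringsOfLength (n : ℕ) : (stringsOfLength n).length = 2 ^ n := by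
  induction n with
  | zero => rfl
  | succ n ih => simp [stringsOfLength, ih, pow_succ]; ring

theorem primrec_stringsOfLength : Primrec stringsOfLength := by
  refine (Primrec.nat_rec₁ (f := fun _ (l : List BinStr) =>
    l.map (List.cons false) ++ l.map (List.cons true)) [[]] ?_).of_eq ?_
  · have h : ∀ b : Bool, Primrec fun q : ℕ × List BinStr => q.2.map (List.cons b) := fun b =>
      Primrec.list_map Primrec.snd (Primrec.list_cons.comp (Primrec.const b) Primrec.snd).to₂
    exact Primrec.list_append.comp (h false) (h true)
  · intro n
    induction n with
    | zero => rfl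
    | succ n ih => rw [stringsOfLength, ← ih]

/-- The binary strings of length less than `k`. -/
def stringsShorter (k : ℕ) : List BinStr :=
  (List.range k).flatMap stringsOfLength

theorem mem_stringsShorter {k : ℕ} {w : BinStr} : w ∈ stringsShorter k ↔ w.length < k := by
  simp [stringsShorter, mem_stringsOfLength]

theorem length_stringsShorter (k : ℕ) : (stringsShorter k).length < 2 ^ k := by
  induction k with
  | zero => simp [stringsShorter]
  | succ k ih =>
    have h : stringsShorter (k + 1) = stringsShorter k ++ stringsOfLength k := by
      simp [stringsShorter, List.range_succ]
    rw [h, List.length_append, length_stringsOfLength, pow_succ]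
    omega

theorem primrec_stringsShorter : Primrec stringsShorter :=
  Primrec.list_flatMap Primrec.list_range (primrec_stringsOfLength.comp Primrec.snd).to₂

/-- The number with the given binary digits, the least significant first. -/
def ofBits (w : BinStr) : ℕ :=
  w.foldr Nat.bit 0

theorem ofBits_bits (n : ℕ) : ofBits n.bits = n := by
  induction n using Nat.binaryRec' with
  | zero => simp [ofBits]
  | bit b n h ih =>
    rw [Nat.bits_append_bit n b h]
    change Nat.bit b (ofBits n.bits) = _
    rw [ih]

theorem primrec_ofBits : Primrec ofBits := by
  have h : Primrec fun q : BinStr × Bool × ℕ => Nat.bit q.2.1 q.2.2 :=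
    (Primrec.cond (Primrec.fst.comp Primrec.snd)
      (Primrec.nat_double_succ.comp (Primrec.snd.comp Primrec.snd))
      (Primrec.nat_double.comp (Primrec.snd.comp Primrec.snd))).of_eq fun q => by
        cases h : q.2.1 <;> simp [Nat.bit]
  exact Primrec.list_foldr Primrec.id (Primrec.const 0) h.to₂

/-- Prefixes a string with a self-delimiting description of a number: `2 * Nat.size k + 1` bits. -/
def withAdvice (k : ℕ) (w : BinStr) : BinStr :=
  List.replicate k.size true ++ false :: (k.bits ++ w)

/-- Splits a string into the number described by its self-delimiting prefix, and the rest. -/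
def splitAdvice (q : BinStr) : ℕ × BinStr :=
  let l := q.findIdx (fun b => !b)
  (ofBits ((q.drop (l + 1)).take l), (q.drop (l + 1)).drop l)

theorem splitAdvice_withAdvice (k : ℕ) (w : BinStr) : splitAdvice (withAdvice k w) = (k, w) := by
  have hidx : ∀ (e : ℕ) (p : BinStr),
      (List.replicate e true ++ false :: p).findIdx (fun b => !b) = e := by
    intro e p
    induction e with
    | zero => simp [List.findIdx_cons]
    | succ e ih => simp [List.replicate_succ, List.findIdx_cons, ih]
  have hdrop : ∀ (e : ℕ) (p : BinStr),
      (List.replicate e true ++ false :: p).drop (e + 1) = p := by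
    intro e p
    induction e with
    | zero => simp
    | succ e ih => simpa [List.replicate_succ] using ih
  unfold splitAdvice withAdvice
  simp only [hidx, hdrop]
  rw [← Nat.size_eq_bits_len, List.take_left, List.drop_left, ofBits_bits]

theorem length_withAdvice (k : ℕ) (w : BinStr) :
    (withAdvice k w).length = w.length + 2 * k.size + 1 := by
  simp [withAdvice, Nat.size_eq_bits_len]
  ring

theorem primrec_splitAdvice : Primrec splitAdvice := by
  have hidx : Primrec (fun q : BinStr => q.findIdx (fun b => !b)) :=
    Primrec.list_findIdx Primrec.id (Primrec.not.comp Primrec.snd).to₂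
  have hdrop : Primrec (fun q : BinStr => q.drop (q.findIdx (fun b => !b) + 1)) :=
    Primrec.list_drop.comp (Primrec.succ.comp hidx) Primrec.id
  exact (primrec_ofBits.comp (Primrec.list_take.comp hidx hdrop)).pair
    (Primrec.list_drop.comp hidx hdrop)

/-- A string representing a pair of strings. Only computability of the encoding matters, so the
pair is encoded by the length. -/
def codePair (a : BinStr × BinStr) : BinStr :=
  List.replicate (Encodable.encode a) true

/-- The pair of strings represented by a string. -/
def decodePair (y : BinStr) : BinStr × BinStr :=
  (Encodable.decode (α := BinStr × BinStr) y.length).getD ([], [])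

theorem decodePair_codePair (a : BinStr × BinStr) : decodePair (codePair a) = a := by
  simp [decodePair, codePair]

theorem primrec_decodePair : Primrec decodePair :=
  Primrec.option_getD.comp (Primrec.decode.comp Primrec.list_length) (Primrec.const ([], []))

theorem primrec_codePair : Primrec codePair :=
  (Primrec.list_map (Primrec.list_range.comp Primrec.encode)
    (Primrec.const true).to₂).of_eq fun a => by simp [codePair]

/-! ### Bounds on conditional complexity -/

theorem condComplexity_le_length {D : BinStr → BinStr →. BinStr} {p y x : BinStr}
    (h : x ∈ D p y) : condComplexity D x y ≤ p.length :=
  Nat.sInf_le ⟨p, h, rfl⟩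

section Bounds

variable {D : BinStr → BinStr →. BinStr}

/-- A description that uses a number `k` as advice costs at most `2 * Nat.size k + O(1)` more bits. -/
theorem IsOptimalDecompressor.exists_le_of_advice (hD : IsOptimalDecompressor D)
    {f : ℕ × BinStr × BinStr →. BinStr} (hf : Partrec f) :
    ∃ c : ℕ, ∀ k p y x, x ∈ f (k, p, y) →
      condComplexity D x y ≤ p.length + 2 * k.size + c := by
  have hcomp : Computable fun q : BinStr × BinStr =>
      ((splitAdvice q.1).1, (splitAdvice q.1).2, q.2) := by
    have h := (primrec_splitAdvice.comp (Primrec.fst (α := BinStr) (β := BinStr))).to_comp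
    exact (Computable.fst.comp h).pair ((Computable.snd.comp h).pair Computable.snd)
  obtain ⟨c, hc⟩ := hD.2 (fun q y => f ((splitAdvice q).1, (splitAdvice q).2, y))
    (hf.comp hcomp)
  refine ⟨c + 1, fun k p y x hx => ?_⟩
  obtain ⟨q, hq, hlen⟩ := hc (withAdvice k p) y x (by rwa [splitAdvice_withAdvice])
  have := condComplexity_le_length hq
  rw [length_withAdvice] at hlen
  omega

/-- Complexity does not grow when the string is transformed by an algorithm, up to a constant. -/
theorem IsOptimalDecompressor.exists_map_le (hD : IsOptimalDecompressor D)
    {g : BinStr → BinStr} (hg : Computable g) :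
    ∃ c : ℕ, ∀ x y, condComplexity D (g x) y ≤ condComplexity D x y + c := by
  obtain ⟨c, hc⟩ := hD.2 (fun p y => (D p y).map g) (hD.1.map (hg.comp Computable.snd).to₂)
  refine ⟨c, fun x y => ?_⟩
  obtain ⟨p, hp, hlen⟩ := hD.exists_shortest x y
  obtain ⟨q, hq, hle⟩ := hc p y _ (Part.mem_map g hp)
  exact (condComplexity_le_length hq).trans (by omega)

/-- Complexity does not decrease when the condition is transformed by an algorithm that uses a
number `k` as advice, up to `2 * Nat.size k + O(1)`. -/
theorem IsOptimalDecompressor.exists_le_map_cond (hD : IsOptimalDecompressor D)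
    {g : ℕ → BinStr → BinStr} (hg : Computable₂ g) :
    ∃ c : ℕ, ∀ k x y, condComplexity D x y ≤ condComplexity D x (g k y) + 2 * k.size + c := by
  have hf : Partrec fun q : ℕ × BinStr × BinStr => D q.2.1 (g q.1 q.2.2) :=
    hD.1.comp (Computable.fst.comp Computable.snd)
      (hg.comp Computable.fst (Computable.snd.comp Computable.snd))
  obtain ⟨c, hc⟩ := hD.exists_le_of_advice hf
  refine ⟨c, fun k x y => ?_⟩
  obtain ⟨p, hp, hlen⟩ := hD.exists_shortest x (g k y)
  rw [← hlen]
  exact hc k p y x hp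

/-- An invertible change of a pair, computable in both directions, changes both complexities that
involve the pair by a bounded amount. -/
theorem IsOptimalDecompressor.exists_abs_sub_le (hD : IsOptimalDecompressor D)
    {g h : BinStr × BinStr → BinStr × BinStr} (hg : Computable g) (hh : Computable h) :
    ∃ c : ℕ, ∀ a x, h (g a) = a →
      |(condComplexity D x (codePair (g a)) : ℤ) - condComplexity D x (codePair a)| ≤ c ∧
      |(condComplexity D (codePair (g a)) x : ℤ) - condComplexity D (codePair a) x| ≤ c := by
  have lift : ∀ f : BinStr × BinStr → BinStr × BinStr, Computable f →
      ∃ c : ℕ, ∀ a x,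
        condComplexity D x (codePair a) ≤ condComplexity D x (codePair (f a)) + c ∧
        condComplexity D (codePair (f a)) x ≤ condComplexity D (codePair a) x + c := by
    intro f hf
    have hF : Computable fun y => codePair (f (decodePair y)) :=
      primrec_codePair.to_comp.comp (hf.comp primrec_decodePair.to_comp)
    obtain ⟨c₁, hc₁⟩ := hD.exists_map_le hF
    obtain ⟨c₂, hc₂⟩ := hD.exists_le_map_cond (g := fun _ y => codePair (f (decodePair y)))
      (hF.comp Computable.snd).to₂
    refine ⟨c₁ + c₂, fun a x => ?_⟩
    have h₁ := hc₁ (codePair a) x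
    have h₂ := hc₂ 0 x (codePair a)
    simp only [decodePair_codePair, Nat.size_zero] at h₁ h₂
    omega
  obtain ⟨c₁, h₁⟩ := lift g hg
  obtain ⟨c₂, h₂⟩ := lift h hh
  refine ⟨c₁ + c₂, fun a x hinv => ?_⟩
  have e₁ := h₁ a x
  have e₂ := h₂ (g a) x
  rw [hinv] at e₂
  rw [abs_le, abs_le]
  omega

/-- Removing the first symbol of a component of a pair changes the complexities that involve the
pair by a bounded amount. -/
theorem IsOptimalDecompressor.exists_abs_sub_drop_le (hD : IsOptimalDecompressor D) :
    ∃ c : ℕ, ∀ (u v x : BinStr) (i j : ℕ),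
      (|(condComplexity D x (codePair (u.drop (i + 1), v.drop j)) : ℤ) -
          condComplexity D x (codePair (u.drop i, v.drop j))| ≤ c ∧
        |(condComplexity D (codePair (u.drop (i + 1), v.drop j)) x : ℤ) -
          condComplexity D (codePair (u.drop i, v.drop j)) x| ≤ c) ∧
      (|(condComplexity D x (codePair (u.drop i, v.drop (j + 1))) : ℤ) -
          condComplexity D x (codePair (u.drop i, v.drop j))| ≤ c ∧
        |(condComplexity D (codePair (u.drop i, v.drop (j + 1))) x : ℤ) -
          condComplexity D (codePair (u.drop i, v.drop j)) x| ≤ c) := by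
  have tail₁ : Computable fun a : BinStr × BinStr => (a.1.tail, a.2) :=
    ((Primrec.list_tail.comp Primrec.fst).pair Primrec.snd).to_comp
  have tail₂ : Computable fun a : BinStr × BinStr => (a.1, a.2.tail) :=
    (Primrec.fst.pair (Primrec.list_tail.comp Primrec.snd)).to_comp
  have cons₁ : ∀ b : Bool, Computable fun a : BinStr × BinStr => (b :: a.1, a.2) := fun b =>
    ((Primrec.list_cons.comp (Primrec.const b) Primrec.fst).pair Primrec.snd).to_comp
  have cons₂ : ∀ b : Bool, Computable fun a : BinStr × BinStr => (a.1, b :: a.2) := fun b =>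
    (Primrec.fst.pair (Primrec.list_cons.comp (Primrec.const b) Primrec.snd)).to_comp
  choose c₁ h₁ using fun b => hD.exists_abs_sub_le tail₁ (cons₁ b)
  choose c₂ h₂ using fun b => hD.exists_abs_sub_le tail₂ (cons₂ b)
  have m₁ : ∀ b, c₁ b ≤ c₁ false + c₁ true := by intro b; cases b <;> omega
  have m₂ : ∀ b, c₂ b ≤ c₂ false + c₂ true := by intro b; cases b <;> omega
  refine ⟨c₁ false + c₁ true + (c₂ false + c₂ true), fun u v x i j => ⟨?_, ?_⟩⟩
  · rw [← List.tail_drop]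
    rcases u.drop i with _ | ⟨b, w⟩
    · simp; positivity
    · have h := h₁ b (b :: w, v.drop j) x rfl
      have hc : (c₁ b : ℤ) ≤ (c₁ false + c₁ true + (c₂ false + c₂ true) : ℕ) := by
        have := m₁ b
        omega
      exact ⟨h.1.trans hc, h.2.trans hc⟩
  · rw [← List.tail_drop]
    rcases v.drop j with _ | ⟨b, w⟩
    · simp; positivity
    · have h := h₂ b (u.drop i, b :: w) x rfl
      have hc : (c₂ b : ℤ) ≤ (c₁ false + c₁ true + (c₂ false + c₂ true) : ℕ) := by
        have := m₂ b
        omega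
      exact ⟨h.1.trans hc, h.2.trans hc⟩

/-- Every string has a shortest description whose final segments are simple given the string:
take the shortest description that is found first. -/
theorem IsOptimalDecompressor.exists_simple_shortest (hD : IsOptimalDecompressor D) :
    ∃ c : ℕ, ∀ x : BinStr, ∃ p : BinStr, x ∈ D p [] ∧ p.length = plainComplexity D x ∧
      ∀ i, condComplexity D (codePair (p.drop i, [])) x ≤
        2 * (Nat.pair (plainComplexity D x) i).size + c := by
  obtain ⟨F, hF, -, hFD'⟩ := Partrec.exists_primrec_approx hD.1
  have hFD : ∀ p y b, b ∈ D p y ↔ ∃ t, F t (p, y) = some b := fun p y b => hFD' (p, y) b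
  let E : BinStr × ℕ → ℕ → Option BinStr := fun a N =>
    (Encodable.decode (α := ℕ × BinStr) N).bind fun s =>
      if s.2.length = a.2 ∧ F s.1 (s.2, []) = some a.1 then some s.2 else none
  have hE : Primrec₂ E := by
    refine Primrec.option_bind (Primrec.decode.comp Primrec.snd) ?_
    have hs : Primrec fun r : ((BinStr × ℕ) × ℕ) × ℕ × BinStr => r.2.2 :=
      Primrec.snd.comp Primrec.snd
    refine Primrec.ite (PrimrecPred.and ?_ ?_) (Primrec.option_some.comp hs) (Primrec.const none)
    · exact Primrec.eq.comp (Primrec.list_length.comp hs)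
        (Primrec.snd.comp (Primrec.fst.comp Primrec.fst))
    · exact Primrec.eq.comp
        (hF.comp (Primrec.fst.comp Primrec.snd) (hs.pair (Primrec.const [])))
        (Primrec.option_some.comp (Primrec.fst.comp (Primrec.fst.comp Primrec.fst)))
  have hsearch : Partrec fun a => Nat.rfindOpt (E a) := Partrec.rfindOpt hE.to_comp
  have hmem : ∀ x k N p, E (x, k) N = some p → x ∈ D p [] ∧ p.length = k := by
    intro x k N p h
    obtain ⟨⟨t, p'⟩, -, h⟩ := Option.bind_eq_some_iff.1 h
    split_ifs at h with hif
    · obtain rfl := Option.some.inj h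
      exact ⟨(hFD _ _ _).2 ⟨t, hif.2⟩, hif.1⟩
  have hf : Partrec fun q : ℕ × BinStr × BinStr =>
      (Nat.rfindOpt (E (q.2.2, q.1.unpair.1))).map
        fun p => codePair (p.drop q.1.unpair.2, ([] : BinStr)) := by
    have hN : Primrec fun q : ℕ × BinStr × BinStr => q.1.unpair :=
      Primrec.unpair.comp Primrec.fst
    refine Partrec.map (hsearch.comp (Primrec.to_comp
      ((Primrec.snd.comp Primrec.snd).pair (Primrec.fst.comp hN)))) (Primrec.to_comp ?_)
    exact primrec_codePair.comp ((Primrec.list_drop.comp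
      (Primrec.snd.comp (hN.comp Primrec.fst)) Primrec.snd).pair (Primrec.const []))
  obtain ⟨c, hc⟩ := hD.exists_le_of_advice hf
  refine ⟨c, fun x => ?_⟩
  obtain ⟨p₀, hp₀, hlen₀⟩ := hD.exists_shortest x []
  obtain ⟨t₀, ht₀⟩ := (hFD _ _ _).1 hp₀
  have hdom : (Nat.rfindOpt (E (x, plainComplexity D x))).Dom := by
    refine Nat.rfindOpt_dom.2 ⟨Encodable.encode (t₀, p₀), p₀, ?_⟩
    simp only [E, Encodable.encodek, Option.bind_some, Option.mem_def]
    exact if_pos ⟨hlen₀, ht₀⟩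
  obtain ⟨p, hp⟩ := Part.dom_iff_mem.1 hdom
  obtain ⟨N, hN⟩ := Nat.rfindOpt_spec hp
  obtain ⟨hxp, hlen⟩ := hmem _ _ _ _ hN
  refine ⟨p, hxp, hlen, fun i => ?_⟩
  have h := hc (Nat.pair (plainComplexity D x) i) [] x (codePair (p.drop i, [])) (by
    simp only [Nat.unpair_pair]
    exact Part.mem_map (fun p : BinStr => codePair (p.drop i, [])) hp)
  simpa using h

/-- A string that has complexity less than `k` under at least half of the conditions of length `T`
has plain complexity at most `k + O(log (k + T))`: there are at most `2 ^ (k + 1)` such strings,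
and they can be enumerated. -/
theorem IsOptimalDecompressor.exists_plainComplexity_le_of_half (hD : IsOptimalDecompressor D) :
    ∃ c : ℕ, ∀ (k T : ℕ) (x : BinStr),
      2 ^ T ≤ 2 * ((stringsOfLength T).filter fun z => condComplexity D x z < k).length →
      plainComplexity D x ≤ k + 1 + 2 * (Nat.pair k T).size + c := by
  obtain ⟨F, hF, hmono, hFD'⟩ := Partrec.exists_primrec_approx hD.1
  have hFD : ∀ p y b, b ∈ D p y ↔ ∃ t, F t (p, y) = some b := fun p y b => hFD' (p, y) b
  -- `R t k x z`: within `t` steps, `x` is seen to have complexity less than `k` given `z`.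
  let R : (ℕ × ℕ × BinStr) → BinStr → Prop := fun s z =>
    ∃ p ∈ stringsShorter s.2.1, F s.1 (p, z) = some s.2.2
  have hRdec : ∀ s z, Decidable (R s z) := fun s z =>
    inferInstanceAs (Decidable (∃ p ∈ stringsShorter s.2.1, F s.1 (p, z) = some s.2.2))
  have hR : PrimrecRel fun (z : BinStr) (s : ℕ × ℕ × BinStr) => R s z := by
    have h1 : PrimrecRel fun (p : BinStr) (a : BinStr × ℕ × ℕ × BinStr) =>
        F a.2.1 (p, a.1) = some a.2.2.2 :=
      Primrec.eq.comp
        (hF.comp (Primrec.fst.comp (Primrec.snd.comp Primrec.snd))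
          (Primrec.fst.pair (Primrec.fst.comp Primrec.snd)))
        (Primrec.option_some.comp
          (Primrec.snd.comp (Primrec.snd.comp (Primrec.snd.comp Primrec.snd))))
    exact h1.exists_mem_list.comp
      (primrec_stringsShorter.comp (Primrec.fst.comp (Primrec.snd.comp Primrec.snd)))
      Primrec.id
  let count : (ℕ × ℕ × BinStr) → ℕ → ℕ := fun s T =>
    ((stringsOfLength T).filter fun z => R s z).length
  have hcount : Primrec₂ count :=
    Primrec.list_length.comp (hR.listFilter.comp (primrec_stringsOfLength.comp Primrec.snd)
      Primrec.fst)
  let E : ℕ × ℕ → ℕ → Option BinStr := fun a N =>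
    (Encodable.decode (α := ℕ × BinStr) N).bind fun s =>
      if (stringsOfLength a.2).length ≤ 2 * count (s.1, a.1, s.2) a.2 then some s.2 else none
  have hE : Primrec₂ E := by
    refine Primrec.option_bind (Primrec.decode.comp Primrec.snd) ?_
    have ha : Primrec fun r : ((ℕ × ℕ) × ℕ) × ℕ × BinStr => r.1.1 :=
      Primrec.fst.comp Primrec.fst
    refine Primrec.ite (Primrec.nat_le.comp ?_ ?_)
      (Primrec.option_some.comp (Primrec.snd.comp Primrec.snd)) (Primrec.const none)
    · exact Primrec.list_length.comp (primrec_stringsOfLength.comp (Primrec.snd.comp ha))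
    · refine Primrec.nat_mul.comp (Primrec.const 2) (hcount.comp ?_ (Primrec.snd.comp ha))
      exact (Primrec.fst.comp Primrec.snd).pair
        ((Primrec.fst.comp ha).pair (Primrec.snd.comp Primrec.snd))
  have hEmem : ∀ k T N x, E (k, T) N = some x → ∃ t, 2 ^ T ≤ 2 * count (t, k, x) T := by
    intro k T N x h
    obtain ⟨⟨t, x'⟩, -, h⟩ := Option.bind_eq_some_iff.1 h
    split_ifs at h with hif
    · obtain rfl := Option.some.inj h
      rw [length_stringsOfLength] at hif
      exact ⟨t, hif⟩
  obtain ⟨f, hf, hrank⟩ := exists_partrec_rank hE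
  have hdec : Partrec fun q : ℕ × BinStr × BinStr => f (q.1.unpair, ofBits q.2.1) :=
    hf.comp ((Primrec.unpair.comp Primrec.fst).pair
      (primrec_ofBits.comp (Primrec.fst.comp Primrec.snd))).to_comp
  obtain ⟨c, hc⟩ := hD.exists_le_of_advice hdec
  refine ⟨c, fun k T x hx => ?_⟩
  -- Double counting: each condition serves fewer than `2 ^ k` strings.
  have hcard : ∀ l : List BinStr, l.Nodup → (∀ b ∈ l, ∃ N, E (k, T) N = some b) →
      l.length ≤ 2 ^ (k + 1) := by
    classical
    intro l hl hlE
    let S : BinStr → BinStr → Prop := fun b z => ∃ p ∈ stringsShorter k, b ∈ D p z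
    have hrow : ∀ b ∈ l.toFinset,
        2 ^ T ≤ 2 * ((stringsOfLength T).toFinset.bipartiteAbove S b).card := by
      intro b hb
      obtain ⟨N, hN⟩ := hlE b (List.mem_toFinset.1 hb)
      obtain ⟨t, ht⟩ := hEmem _ _ _ _ hN
      refine ht.trans (Nat.mul_le_mul_left 2 ?_)
      simp only [count]
      rw [← List.toFinset_card_of_nodup ((stringsOfLength_nodup T).filter _)]
      refine Finset.card_le_card fun z hz => ?_
      simp only [List.mem_toFinset, List.mem_filter, decide_eq_true_eq] at hz
      obtain ⟨hz, p, hp, hpF⟩ := hz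
      exact Finset.mem_filter.2 ⟨List.mem_toFinset.2 hz, p, hp, (hFD _ _ _).2 ⟨t, hpF⟩⟩
    have hcol : ∀ z ∈ (stringsOfLength T).toFinset,
        (l.toFinset.bipartiteBelow S z).card ≤ 2 ^ k := by
      intro z _
      have hex : ∀ b ∈ l.toFinset.bipartiteBelow S z, S b z := fun b hb =>
        (Finset.mem_filter.1 hb).2
      choose! d hd hdD using hex
      calc (l.toFinset.bipartiteBelow S z).card
          ≤ (stringsShorter k).toFinset.card := by
            refine Finset.card_le_card_of_injOn d
              (fun b hb => List.mem_toFinset.2 (hd b hb)) fun b hb b' hb' h => ?_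
            have h₁ := hdD b hb
            rw [h] at h₁
            exact Part.mem_unique h₁ (hdD b' hb')
        _ ≤ (stringsShorter k).length := List.toFinset_card_le _
        _ ≤ 2 ^ k := (length_stringsShorter k).le
    have hsum := Finset.sum_card_bipartiteAbove_eq_sum_card_bipartiteBelow S
      (s := l.toFinset) (t := (stringsOfLength T).toFinset)
    have h₁ : l.length * 2 ^ T ≤
        2 * ∑ b ∈ l.toFinset, ((stringsOfLength T).toFinset.bipartiteAbove S b).card := by
      rw [Finset.mul_sum, ← List.toFinset_card_of_nodup hl, ← smul_eq_mul]
      exact Finset.card_nsmul_le_sum _ _ _ hrow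
    have h₂ : ∑ z ∈ (stringsOfLength T).toFinset, (l.toFinset.bipartiteBelow S z).card ≤
        2 ^ T * 2 ^ k := by
      refine (Finset.sum_le_card_nsmul _ _ _ hcol).trans ?_
      rw [List.toFinset_card_of_nodup (stringsOfLength_nodup T), length_stringsOfLength,
        smul_eq_mul]
    rw [hsum] at h₁
    have h₃ : l.length * 2 ^ T ≤ 2 ^ (k + 1) * 2 ^ T := by
      rw [pow_succ]; nlinarith
    exact Nat.le_of_mul_le_mul_right h₃ (by positivity)
  -- Finitely many descriptions are all found within a common time.
  have htime : ∀ l : List BinStr, ∃ t, ∀ z ∈ l, condComplexity D x z < k → R (t, k, x) z := by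
    intro l
    induction l with
    | nil => exact ⟨0, by simp⟩
    | cons z l ih =>
      obtain ⟨t, ht⟩ := ih
      obtain ⟨p, hp, hlen⟩ := hD.exists_shortest x z
      obtain ⟨t', ht'⟩ := (hFD _ _ _).1 hp
      refine ⟨max t t', fun z' hz' hk => ?_⟩
      rcases List.mem_cons.1 hz' with rfl | hz'
      · exact ⟨p, mem_stringsShorter.2 (hlen ▸ hk), hmono _ _ _ _ (le_max_right _ _) ht'⟩
      · obtain ⟨p', hp', h⟩ := ht z' hz' hk
        exact ⟨p', hp', hmono _ _ _ _ (le_max_left _ _) h⟩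
  obtain ⟨t, ht⟩ := htime (stringsOfLength T)
  have hxE : E (k, T) (Encodable.encode (t, x)) = some x := by
    simp only [E, Encodable.encodek, Option.bind_some]
    refine if_pos ?_
    rw [length_stringsOfLength]
    refine hx.trans (Nat.mul_le_mul_left 2 ?_)
    simp only [count]
    rw [← List.countP_eq_length_filter, ← List.countP_eq_length_filter]
    refine List.countP_mono_left fun z hz h => ?_
    simp only [decide_eq_true_eq] at h ⊢
    exact ht z hz h
  obtain ⟨r, hr, hxr⟩ := hrank (k, T) x _ hcard ⟨_, hxE⟩
  have h := hc (Nat.pair k T) r.bits [] x (by simpa [ofBits_bits] using hxr)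
  rw [Nat.size_eq_bits_len] at h
  have hsize := Nat.size_le.2 hr
  exact h.trans (by omega)

/-- Some string of length `T + 1` is incompressible given `x` and of little help in describing
`x`. -/
theorem IsOptimalDecompressor.exists_independent (hD : IsOptimalDecompressor D) :
    ∃ c : ℕ, ∀ (x : BinStr) (T : ℕ), ∃ z : BinStr, z.length = T + 1 ∧
      T ≤ condComplexity D z x ∧
      plainComplexity D x ≤
        condComplexity D x z + 2 * (Nat.pair (plainComplexity D x) (T + 1)).size + c := by
  obtain ⟨c, hc⟩ := hD.exists_plainComplexity_le_of_half
  refine ⟨c + 2, fun x T => ?_⟩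
  by_contra! hcon
  set K := plainComplexity D x with hK
  set s := (Nat.pair K (T + 1)).size with hs
  have hcompress : ((stringsOfLength (T + 1)).filter fun z => condComplexity D z x < T).length ≤
      2 ^ T := by
    choose d hd hdlen using fun z => hD.exists_shortest z x
    rw [← List.toFinset_card_of_nodup ((stringsOfLength_nodup _).filter _)]
    calc _ ≤ (stringsShorter T).toFinset.card := by
          refine Finset.card_le_card_of_injOn d (fun z hz => ?_) fun z _ z' _ h => ?_
          · simp only [List.coe_toFinset, List.mem_filter, Set.mem_ofPred_eq,
              decide_eq_true_eq] at hz
            exact List.mem_toFinset.2 (mem_stringsShorter.2 (hdlen z ▸ hz.2))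
          · have h₁ := hd z
            rw [h] at h₁
            exact Part.mem_unique h₁ (hd z')
      _ ≤ (stringsShorter T).length := List.toFinset_card_le _
      _ ≤ 2 ^ T := (length_stringsShorter T).le
  have hle : plainComplexity D x ≤ (K - (2 * s + (c + 2))) + 1 +
      2 * (Nat.pair (K - (2 * s + (c + 2))) (T + 1)).size + c := by
    refine hc _ _ x ?_
    have hsplit := List.length_eq_length_filter_add (l := stringsOfLength (T + 1))
      (fun z => decide (condComplexity D z x < T))
    have hsub : ((stringsOfLength (T + 1)).filter
          fun z => !decide (condComplexity D z x < T)).length ≤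
        ((stringsOfLength (T + 1)).filter
          fun z => decide (condComplexity D x z < K - (2 * s + (c + 2)))).length := by
      rw [← List.countP_eq_length_filter, ← List.countP_eq_length_filter]
      refine List.countP_mono_left fun z hz h => ?_
      simp only [Bool.not_eq_true', decide_eq_false_iff_not, not_lt, decide_eq_true_eq] at h ⊢
      have := hcon z (mem_stringsOfLength.1 hz) h
      omega
    rw [length_stringsOfLength, pow_succ] at hsplit
    rw [pow_succ]
    omega
  have hmono : (Nat.pair (K - (2 * s + (c + 2))) (T + 1)).size ≤ s := by
    refine Nat.size_le_size ?_
    rcases (Nat.sub_le K (2 * s + (c + 2))).eq_or_lt with h | h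
    · rw [h]
    · exact (Nat.pair_lt_pair_left _ h).le
  -- The subtraction above does not truncate, since some string is incompressible given `x`.
  obtain ⟨z, hz, hzT⟩ : ∃ z : BinStr, z.length = T + 1 ∧ T ≤ condComplexity D z x := by
    by_contra! hall
    rw [List.filter_eq_self.2 fun z hz => by
      simpa using hall z (mem_stringsOfLength.1 hz), length_stringsOfLength, pow_succ] at hcompress
    have : 0 < 2 ^ T := by positivity
    omega
  have := hcon z hz hzT
  omega

end Bounds

/-! ### Logarithmic bounds -/

/-- A real polynomial is bounded on the positive integers by a monomial with natural data. -/
theorem Polynomial.exists_eval_le_mul_pow (P : Polynomial ℝ) :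
    ∃ A d : ℕ, ∀ n : ℕ, 1 ≤ n → P.eval (n : ℝ) ≤ (A * n ^ d : ℕ) := by
  obtain ⟨A, hA⟩ := exists_nat_ge (∑ i ∈ Finset.range (P.natDegree + 1), |P.coeff i|)
  refine ⟨A, P.natDegree, fun n hn => ?_⟩
  have hn' : (1 : ℝ) ≤ n := by exact_mod_cast hn
  rw [Polynomial.eval_eq_sum_range]
  calc ∑ i ∈ Finset.range (P.natDegree + 1), P.coeff i * (n : ℝ) ^ i
      ≤ ∑ i ∈ Finset.range (P.natDegree + 1), |P.coeff i| * (n : ℝ) ^ P.natDegree := by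
        refine Finset.sum_le_sum fun i hi => ?_
        have hi' := Finset.mem_range_succ_iff.1 hi
        exact mul_le_mul (le_abs_self _) (pow_le_pow_right₀ hn' hi') (by positivity)
          (abs_nonneg _)
    _ ≤ (A : ℝ) * (n : ℝ) ^ P.natDegree := by
        rw [← Finset.sum_mul]
        exact mul_le_mul_of_nonneg_right hA (by positivity)
    _ = ((A * n ^ P.natDegree : ℕ) : ℝ) := by push_cast; ring

/-- The binary length of a pair of polynomially bounded numbers is logarithmic. -/
theorem exists_size_pair_le_logb (A d : ℕ) :
    ∃ B : ℕ, ∀ n a b : ℕ, 2 ≤ n → a ≤ A * n ^ d → b ≤ A * n ^ d →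
      ((Nat.pair a b).size : ℝ) ≤ B * Real.logb 2 n := by
  refine ⟨2 * ((A + 1).size + 2 * d), fun n a b hn ha hb => ?_⟩
  have hlog : 1 ≤ Real.logb 2 n := by
    rw [Real.le_logb_iff_rpow_le (by norm_num) (by positivity)]
    simpa using (by exact_mod_cast hn : (2 : ℝ) ≤ n)
  have hsize : (n.size : ℝ) ≤ 2 * Real.logb 2 n := by
    have hpos : 0 < n.size := Nat.size_pos.2 (by omega)
    have h : 2 ^ (n.size - 1) ≤ n := Nat.lt_size.1 (by omega)
    have h' : ((n.size - 1 : ℕ) : ℝ) ≤ Real.logb 2 n := by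
      rw [Real.le_logb_iff_rpow_le (by norm_num) (by positivity), Real.rpow_natCast]
      exact_mod_cast h
    rw [Nat.cast_sub hpos] at h'
    push_cast at h'
    linarith
  have hpair : (Nat.pair a b).size ≤ 2 * ((A + 1).size + d * n.size) := by
    refine Nat.size_le.2 ((Nat.pair_lt_max_add_one_sq a b).trans_le ?_)
    rw [mul_comm 2, pow_mul]
    refine Nat.pow_le_pow_left ?_ 2
    have hnd : 1 ≤ n ^ d := Nat.one_le_pow _ _ (by omega)
    calc max a b + 1 ≤ A * n ^ d + n ^ d := by
          have := max_le ha hb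
          omega
      _ = (A + 1) * n ^ d := by ring
      _ ≤ 2 ^ (A + 1).size * (2 ^ n.size) ^ d :=
          Nat.mul_le_mul (Nat.lt_size_self _).le (Nat.pow_le_pow_left (Nat.lt_size_self _).le _)
      _ = 2 ^ ((A + 1).size + d * n.size) := by rw [pow_add, ← pow_mul, mul_comm d]
  have hpair' : ((Nat.pair a b).size : ℝ) ≤ 2 * ((A + 1).size + d * n.size) := by
    exact_mod_cast hpair
  push_cast
  have hA : (0 : ℝ) ≤ (A + 1).size := by positivity
  have hd : (0 : ℝ) ≤ d := by positivity
  nlinarith [mul_le_mul_of_nonneg_left hsize hd, mul_le_mul_of_nonneg_left hlog hA]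

/-! ### The two-parameter family of conditions -/

/-- The theorem without polynomials and logarithms: `n` and `m` are realized up to a constant as
soon as they leave room for the advice used in the construction. -/
theorem IsOptimalDecompressor.exists_near {D : BinStr → BinStr →. BinStr}
    (hD : IsOptimalDecompressor D) :
    ∃ c : ℕ, ∀ (x : BinStr) (n m s : ℕ),
      (∀ i ≤ plainComplexity D x, (Nat.pair (plainComplexity D x) i).size ≤ s) →
      (Nat.pair (plainComplexity D x) (m + c)).size ≤ s → (m + c).size ≤ s →
      n + 4 * s + c ≤ plainComplexity D x → 2 * s + c ≤ m →
      ∃ y : BinStr, |(condComplexity D x y : ℤ) - n| ≤ c ∧ |(condComplexity D y x : ℤ) - m| ≤ c := by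
  obtain ⟨c₁, hstep⟩ := hD.exists_abs_sub_drop_le
  obtain ⟨c₂, hshort⟩ := hD.exists_simple_shortest
  obtain ⟨c₃, hindep⟩ := hD.exists_independent
  -- The first component of the condition, if complete, describes `x`.
  have hfst : Partrec fun q : ℕ × BinStr × BinStr => D (decodePair q.2.2).1 [] :=
    Partrec₂.comp hD.1 (Primrec.fst.comp
      (primrec_decodePair.comp (Primrec.snd.comp Primrec.snd))).to_comp (Computable.const [])
  obtain ⟨c₄, hdescr⟩ := hD.exists_le_of_advice hfst
  have hdrop : Computable₂ fun (j : ℕ) (z : BinStr) => codePair (([] : BinStr), z.drop j) :=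
    (primrec_codePair.comp ((Primrec.const []).pair
      (Primrec.list_drop.comp Primrec.fst Primrec.snd))).to_comp
  obtain ⟨c₅, hcond⟩ := hD.exists_le_map_cond hdrop
  obtain ⟨c₆, hsnd⟩ := hD.exists_map_le (g := fun y => (decodePair y).2)
    (Primrec.snd.comp primrec_decodePair).to_comp
  -- The step bound counts twice: the levels are met up to `2 * c₁`.
  obtain ⟨c, hc⟩ : ∃ c, c = 2 * c₁ + c₂ + c₃ + c₄ + c₅ + c₆ + 3 := ⟨_, rfl⟩
  refine ⟨c, fun x n m s hs hs' hs'' hn hm => ?_⟩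
  obtain ⟨p, hp, hplen, hpsimple⟩ := hshort x
  -- The surplus `1 + c₆` makes the complexity of a pair with second component `z` exceed `m`.
  obtain ⟨z, hzlen, hz, hxz⟩ := hindep x (m + (1 + c₆))
  have hzsize : (Nat.pair (plainComplexity D x) (m + (1 + c₆) + 1)).size ≤ s := by
    refine (Nat.size_le_size ?_).trans hs'
    rcases (show m + (1 + c₆) + 1 ≤ m + c by omega).eq_or_lt with h | h
    · rw [h]
    · exact (Nat.pair_lt_pair_right _ h).le
  have hleft : ∀ j, condComplexity D x (codePair (p.drop 0, z.drop j)) < n + (c₄ + 1) := by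
    intro j
    have h := hdescr 0 [] (codePair (p.drop 0, z.drop j)) x
      (by simpa [decodePair_codePair] using hp)
    simp only [List.length_nil, Nat.size_zero] at h
    omega
  have hright : ∀ j ≤ z.length,
      n + (c₄ + 1) ≤ condComplexity D x (codePair (p.drop p.length, z.drop j)) := by
    intro j hj
    have h := hcond j x z
    have hjs : j.size ≤ s := (Nat.size_le_size (by omega)).trans hs''
    rw [List.drop_length]
    omega
  have hbot : ∀ i, m + 1 ≤ condComplexity D (codePair (p.drop i, z.drop 0)) x := by
    intro i
    have h := hsnd (codePair (p.drop i, z.drop 0)) x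
    rw [decodePair_codePair, List.drop_zero] at h
    dsimp only at h
    rw [List.drop_zero]
    omega
  have htop : ∀ i ≤ p.length,
      condComplexity D (codePair (p.drop i, z.drop z.length)) x < m + 1 := by
    intro i hi
    have h := hpsimple i
    have hsi := hs i (hplen ▸ hi)
    rw [List.drop_length]
    omega
  obtain ⟨i, j, hi, hj⟩ := exists_near_levels
    (fun i j => condComplexity D x (codePair (p.drop i, z.drop j)))
    (fun i j => condComplexity D (codePair (p.drop i, z.drop j)) x)
    p.length z.length (n + (c₄ + 1) : ℕ) (m + 1 : ℕ) c₁
    (fun i j => (hstep p z x i j).1.1) (fun i j => (hstep p z x i j).2.1)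
    (fun i j => (hstep p z x i j).1.2) (fun i j => (hstep p z x i j).2.2)
    (fun j => Int.ofNat_lt.2 (hleft j)) (fun j hj => Int.ofNat_le.2 (hright j hj))
    (fun i => Int.ofNat_le.2 (hbot i)) (fun i hi => Int.ofNat_lt.2 (htop i hi))
  refine ⟨codePair (p.drop i, z.drop j), ?_, ?_⟩
  · rw [abs_le] at hi ⊢
    push_cast at hi
    omega
  · rw [abs_le] at hj ⊢
    push_cast at hj
    omega

theorem theorem1 (D : BinStr → BinStr →. BinStr) (hD : IsOptimalDecompressor D)
    (P : Polynomial ℝ) :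
    ∃ c : ℝ, 0 < c ∧ ∀ (x : BinStr) (n m : ℤ), 0 < n →
      (n : ℝ) + c * Real.logb 2 (n : ℝ) ≤ (plainComplexity D x : ℝ) →
      (plainComplexity D x : ℝ) ≤ P.eval (n : ℝ) →
      c * Real.logb 2 (n : ℝ) ≤ (m : ℝ) →
      (m : ℝ) ≤ P.eval (n : ℝ) →
      ∃ y : BinStr,
        |(condComplexity D x y : ℝ) - (n : ℝ)| ≤ c ∧
        |(condComplexity D y x : ℝ) - (m : ℝ)| ≤ c := by
  obtain ⟨c₁, hnear⟩ := hD.exists_near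
  obtain ⟨c₂, hempty⟩ := hD.exists_le_of_advice
    (f := fun _ => Part.some []) (Computable.const []).partrec
  obtain ⟨A, d, hP⟩ := P.exists_eval_le_mul_pow
  obtain ⟨B, hB⟩ := exists_size_pair_le_logb (A + c₁) d
  refine ⟨4 * B + c₁ + c₂ + |P.eval 1| + 1, by positivity, fun x n m hn hK₁ hK₂ hm₁ hm₂ => ?_⟩
  have hP₁ := abs_nonneg (P.eval 1)
  lift n to ℕ using hn.le
  have hn' : 0 < n := by exact_mod_cast hn
  have hlog₀ : 0 ≤ Real.logb 2 n := Real.logb_nonneg (by norm_num) (by exact_mod_cast hn')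
  have hm₀ : (0 : ℝ) ≤ m := le_trans (by push_cast; positivity) hm₁
  lift m to ℕ using (by exact_mod_cast hm₀)
  push_cast at *
  rcases (show n = 1 ∨ 2 ≤ n by omega) with rfl | hn₂
  · -- Everything is bounded for `n = 1`, where the logarithm gives no room.
    refine ⟨[], ?_, ?_⟩
    · have h₁ := le_abs_self (P.eval 1)
      rw [Nat.cast_one] at *
      change |(plainComplexity D x : ℝ) - 1| ≤ _
      rw [abs_le]
      have : (0 : ℝ) ≤ plainComplexity D x := by positivity
      constructor <;> linarith [(Nat.cast_nonneg B : (0 : ℝ) ≤ B),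
        (Nat.cast_nonneg c₁ : (0 : ℝ) ≤ c₁), (Nat.cast_nonneg c₂ : (0 : ℝ) ≤ c₂)]
    · have h₁ := le_abs_self (P.eval 1)
      rw [Nat.cast_one] at *
      have h := hempty 0 [] x [] (Part.mem_some _)
      have h' : (condComplexity D [] x : ℝ) ≤ c₂ := by exact_mod_cast (by simpa using h)
      rw [abs_le]
      have : (0 : ℝ) ≤ condComplexity D [] x := by positivity
      constructor <;> linarith [(Nat.cast_nonneg B : (0 : ℝ) ≤ B),
        (Nat.cast_nonneg c₁ : (0 : ℝ) ≤ c₁)]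
  · have hlog : 1 ≤ Real.logb 2 n := by
      rw [Real.le_logb_iff_rpow_le (by norm_num) (by positivity)]
      simpa using (by exact_mod_cast hn₂ : (2 : ℝ) ≤ n)
    have hnd : 1 ≤ n ^ d := Nat.one_le_pow _ _ hn'
    have hKA : plainComplexity D x ≤ A * n ^ d := by exact_mod_cast hK₂.trans (hP n hn')
    have hmA : m ≤ A * n ^ d := by exact_mod_cast hm₂.trans (hP n hn')
    have hA : A * n ^ d + c₁ ≤ (A + c₁) * n ^ d := by nlinarith
    set s := ⌊(B : ℝ) * Real.logb 2 n⌋₊ with hs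
    have hs_le : (s : ℝ) ≤ B * Real.logb 2 n := Nat.floor_le (by positivity)
    have hsize : ∀ b ≤ (A + c₁) * n ^ d, (Nat.pair (plainComplexity D x) b).size ≤ s :=
      fun b hb => Nat.le_floor (hB n _ b hn₂ (by omega) hb)
    have hrest : 0 ≤ (c₁ + c₂ + |P.eval 1| + 1) * (Real.logb 2 n - 1) :=
      mul_nonneg (by positivity) (by linarith)
    have hBl : 0 ≤ B * Real.logb 2 n := by positivity
    obtain ⟨y, hy₁, hy₂⟩ := hnear x n m s (fun i hi => hsize i (by omega))
      (hsize _ (by omega))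
      ((Nat.size_le_size (Nat.right_le_pair (plainComplexity D x) _)).trans (hsize _ (by omega)))
      (by
        have : (n : ℝ) + 4 * s + c₁ ≤ plainComplexity D x := by
          linarith [(Nat.cast_nonneg c₂ : (0 : ℝ) ≤ c₂)]
        exact_mod_cast this)
      (by
        have : (2 : ℝ) * s + c₁ ≤ m := by linarith [(Nat.cast_nonneg c₂ : (0 : ℝ) ≤ c₂)]
        exact_mod_cast this)
    have hle : (c₁ : ℝ) ≤ 4 * B + c₁ + c₂ + |P.eval 1| + 1 := by
      linarith [(Nat.cast_nonneg B : (0 : ℝ) ≤ B), (Nat.cast_nonneg c₂ : (0 : ℝ) ≤ c₂)]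
    refine ⟨y, le_trans ?_ hle, le_trans ?_ hle⟩
    · exact_mod_cast hy₁
    · exact_mod_cast hy₂
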